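/- Let $A=\mathbb{C}^d$ with $d\ge 1$, with a fixed orthonormal basis $\{|i\rangle\}_{i=0}^{d-1}$ (the incoherent basis), and let $\Delta(X)=\sum_i\langle i|X|i\rangle\,|i\rangle\langle i|$ be the dephasing channel; on a composite system the incoherent basis is the product basis. An operator $X$ is incoherent if $\Delta(X)=X$; a measurement (POVM) $\mathcal{M}=\{M_x\}$ is incoherent if all its elements are. Let $D(X\|Y)=\mathrm{tr}\,X\log_2 X-\mathrm{tr}\,X\log_2 Y$ for $X,Y\ge 0$ (with value $+\infty$ if $\operatorname{supp}X\not\subseteq\operatorname{supp}Y$) and, for POVMs on a system of dimension $D_0$ with the same number of outcomes, $D_m(\mathcal{M}\|\mathcal{N})=\frac{1}{D_0}\sum_x D(M_x\|N_x)$. For a quantum channel $\mathcal{E}$ on $A$, the state-cohering power is $$C_g(\mathcal{E})=\sup_{\sigma}\ \inf_{\tau}\ D\big((\mathcal{E}\otimes\mathrm{id}_{\widetilde A})(\sigma)\,\big\|\,\tau\big),$$ where $\sigma$ ranges over the incoherent states of $A\widetilde{A}$ for all finite-dimensional ancillas $\widetilde{A}$, and $\tau$ over the incoherent states of $A\widetilde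 A$. The measurement-cohering power is $$C(\mathcal{E})=\inf_{\mathcal{F}}\ \sup_{\mathcal{M}}\ D_m\big(\mathcal{M}\circ(\mathcal{E}\otimes\mathrm{id}_{\widetilde A})\,\big\|\,\mathcal{M}\circ(\mathcal{F}\otimes\mathrm{id}_{\widetilde A})\big),$$ where $\mathcal{F}$ ranges over the detection-incoherent channels on $A$ (those with $\Delta\circ\mathcal{F}=\Delta\circ\mathcal{F}\circ\Delta$), $\mathcal{M}$ ranges over the incoherent measurements, with any finite number of outcomes, of $A\widetilde{A}$ for all finite-dimensional ancillas $\widetilde{A}$, and $\mathcal{M}\circ\mathcal{G}$ is the POVM $\{\mathcal{G}^\dagger(M_x)\}$. Theorem. For every unital quantum channel $\mathcal{E}$ on $A$ (completely positive, trace preserving, $\mathcal{E}(I)=I$), with Hilbert–Schmidt adjoint $\mathcal{E}^\dagger$, $$\frac{1}{d}\,C_g(\mathcal{E})\ \le\ C(\mathcal{E}^\dagger)\ \le\ C_g(\mathcal{E}).$$ In particular, $C_g(\mathcal{E})\neq 0$ if and only if $C(\mathcal{E}^\dagger)\neq 0$. -/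

import Mathlib

noncomputable section

namespace CoheringPower

open Matrix
open scoped ComplexOrder

variable {ι κ : Type*} [Fintype ι] [DecidableEq ι] [Fintype κ] [DecidableEq κ]

/-- Linear maps on the operators of a finite-dimensional system; the system is `ℂ^ι`, and its
incoherent basis is the standard basis, indexed by `ι`. -/
abbrev SuperOp (ι : Type*) : Type _ := Matrix ι ι ℂ →ₗ[ℂ] Matrix ι ι ℂ

/-- The map `Φ ⊗ id` on the composite system with basis `ι × κ`: the map `Φ` acts on each block
`X_{ab}` of `X = ∑ X_{ab} ⊗ |a⟩⟨b|`. -/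
def ampliate (κ : Type*) (Φ : SuperOp ι) : SuperOp (ι × κ) where
  toFun X := Matrix.of fun p q => Φ (Matrix.of fun i j => X (i, p.2) (j, q.2)) p.1 q.1
  map_add' X Y := by
    ext p q
    have h : (Matrix.of fun i j => (X + Y) (i, p.2) (j, q.2) : Matrix ι ι ℂ) =
        (Matrix.of fun i j => X (i, p.2) (j, q.2)) +
          (Matrix.of fun i j => Y (i, p.2) (j, q.2)) := rfl
    simp only [Matrix.of_apply, Matrix.add_apply] at h ⊢
    rw [h, map_add, Matrix.add_apply]
  map_smul' c X := by
    ext p q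
    have h : (Matrix.of fun i j => (c • X) (i, p.2) (j, q.2) : Matrix ι ι ℂ) =
        c • (Matrix.of fun i j => X (i, p.2) (j, q.2)) := rfl
    simp only [Matrix.of_apply, Matrix.smul_apply, RingHom.id_apply] at h ⊢
    rw [h, map_smul, Matrix.smul_apply]

/-- Complete positivity: `Φ ⊗ id_k` preserves positive semidefiniteness for every `k`. -/
def IsCompletelyPositive (Φ : SuperOp ι) : Prop :=
  ∀ (k : ℕ) (X : Matrix (ι × Fin k) (ι × Fin k) ℂ),
    X.PosSemidef → (ampliate (Fin k) Φ X).PosSemidef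

/-- Quantum channels: completely positive trace-preserving maps. -/
structure IsChannel (Φ : SuperOp ι) : Prop where
  completelyPositive : IsCompletelyPositive Φ
  tracePreserving : ∀ X, (Φ X).trace = X.trace

/-- The map fixes the identity operator. -/
def IsUnital (Φ : SuperOp ι) : Prop := Φ 1 = 1

/-- The adjoint map with respect to the Hilbert-Schmidt inner product `tr (Xᴴ Y)`. -/
def adjointMap (Φ : SuperOp ι) : SuperOp ι where
  toFun Y := Matrix.of fun i j => ((Φ (Matrix.single i j 1))ᴴ * Y).trace
  map_add' Y Z := by
    ext i j
    simp [Matrix.mul_add, Matrix.trace_add]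
  map_smul' c Y := by
    ext i j
    simp [Matrix.trace_smul]

/-- The property that characterizes the adjoint map. -/
theorem trace_conjTranspose_mul_adjointMap (Φ : SuperOp ι) (X Y : Matrix ι ι ℂ) :
    (Xᴴ * adjointMap Φ Y).trace = ((Φ X)ᴴ * Y).trace := by
  have hX : Φ X = ∑ i, ∑ j, X i j • Φ (Matrix.single i j 1) := by
    conv_lhs => rw [Matrix.matrix_eq_sum_single X]
    simp only [map_sum]
    refine Finset.sum_congr rfl fun i _ => Finset.sum_congr rfl fun j _ => ?_
    rw [← map_smul, Matrix.smul_single, smul_eq_mul, mul_one]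
  rw [hX]
  simp only [Matrix.conjTranspose_sum, Matrix.conjTranspose_smul, Finset.sum_mul,
    Matrix.trace_sum, Matrix.smul_mul, Matrix.trace_smul, smul_eq_mul]
  rw [Matrix.trace, Finset.sum_comm]
  refine Finset.sum_congr rfl fun j _ => ?_
  simp only [Matrix.diag_apply, Matrix.mul_apply, Matrix.conjTranspose_apply, adjointMap,
    LinearMap.coe_mk, AddHom.coe_mk, Matrix.of_apply]

/-- The dephasing channel `Δ`: it keeps the diagonal entries and deletes all the others. -/
def dephase : SuperOp ι :=
  Matrix.diagonalLinearMap ι ℂ ℂ ∘ₗ Matrix.diagLinearMap ι ℂ ℂ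

/-- Incoherent operators: the fixed points of the dephasing channel. -/
def IsIncoherent (X : Matrix ι ι ℂ) : Prop := dephase X = X

/-- Quantum states: density matrices. -/
structure IsState (ρ : Matrix ι ι ℂ) : Prop where
  posSemidef : ρ.PosSemidef
  trace_eq_one : ρ.trace = 1

/-- Incoherent states. -/
def IsIncoherentState (ρ : Matrix ι ι ℂ) : Prop := IsState ρ ∧ IsIncoherent ρ

/-- Quantum measurements with `n` outcomes, as positive operator valued measures. -/
structure IsMeasurement {n : ℕ} (M : Fin n → Matrix ι ι ℂ) : Prop where
  posSemidef : ∀ x, (M x).PosSemidef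
  sum_eq_one : ∑ x, M x = 1

/-- Incoherent measurements: all the POVM elements are incoherent. -/
def IsIncoherentMeasurement {n : ℕ} (M : Fin n → Matrix ι ι ℂ) : Prop :=
  IsMeasurement M ∧ ∀ x, IsIncoherent (M x)

/-- Detection-incoherent operations: channels `F` with `Δ ∘ F = Δ ∘ F ∘ Δ`. -/
def IsDIO (F : SuperOp ι) : Prop :=
  IsChannel F ∧ dephase ∘ₗ F = dephase ∘ₗ F ∘ₗ dephase

open Classical in
/-- The quantum relative entropy `D(X‖Y) = tr (X log₂ X) - tr (X log₂ Y)` of positive semidefinite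
matrices; it is `+∞` unless the support of `X` lies in that of `Y` (that is, `ker Y ⊆ ker X`).
As `Real.log 0 = 0`, the functional calculus gives the logarithm on the support. -/
def relEntropy (X Y : Matrix ι ι ℂ) : EReal :=
  if ∀ v : ι → ℂ, Y *ᵥ v = 0 → X *ᵥ v = 0 then
    (((X * cfc Real.log X).trace.re - (X * cfc Real.log Y).trace.re) / Real.log 2 : ℝ)
  else ⊤

/-- The relative entropy of coherence, `min_σ D(ρ‖σ)` over incoherent states `σ`. -/
def cohRelEntropy (ρ : Matrix ι ι ℂ) : EReal :=
  ⨅ (σ : Matrix ι ι ℂ) (_ : IsIncoherentState σ), relEntropy ρ σ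

/-- The state-cohering power: the largest relative entropy of coherence of `(Φ ⊗ id) σ`, where `σ`
is an incoherent state of the system and an ancilla of arbitrary dimension `m`. -/
def stateCoheringPower (Φ : SuperOp ι) : EReal :=
  ⨆ (m : ℕ) (_ : 0 < m) (σ : Matrix (ι × Fin m) (ι × Fin m) ℂ) (_ : IsIncoherentState σ),
    cohRelEntropy (ampliate (Fin m) Φ σ)

/-- The measurement relative entropy: `1 / dim` times the sum of the relative entropies of the POVM
elements, where `dim` is the dimension of the measured system. -/
def measRelEntropy {n : ℕ} (M N : Fin n → Matrix ι ι ℂ) : EReal :=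
  ((1 / (Fintype.card ι : ℝ) : ℝ) : EReal) * ∑ x, relEntropy (M x) (N x)

/-- The measurement `M ∘ Φ`, in which the map `Φ` is applied before `M`. As
`tr (M x * Φ ρ) = tr (Φ† (M x) * ρ)`, its POVM elements are `Φ† (M x)`. -/
def precomp {n : ℕ} (M : Fin n → Matrix ι ι ℂ) (Φ : SuperOp ι) : Fin n → Matrix ι ι ℂ :=
  fun x => adjointMap Φ (M x)

/-- The measurement-cohering power: `min_F max_M D_m (M ∘ (Φ ⊗ id) ‖ M ∘ (F ⊗ id))`, where `F` is a
detection-incoherent operation, and `M` is an incoherent measurement, with any number `n` of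
outcomes, of the system and an ancilla of arbitrary dimension `m`. -/
def measCoheringPower (Φ : SuperOp ι) : EReal :=
  ⨅ (F : SuperOp ι) (_ : IsDIO F),
    ⨆ (m : ℕ) (_ : 0 < m) (n : ℕ) (M : Fin n → Matrix (ι × Fin m) (ι × Fin m) ℂ)
      (_ : IsIncoherentMeasurement M),
      measRelEntropy (precomp M (ampliate (Fin m) Φ)) (precomp M (ampliate (Fin m) F))

end CoheringPower

end

/-! Both powers are governed by `coherence X`, that is D(X‖Δ(X)). For positive X and incoherent Y,
D(X‖Y) is at least `coherence X` plus (tr X − tr Y)/ln 2 (`coherence_add_le_relEntropy`). So Δ(ρ) is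
the optimal comparison for a state ρ, and for POVMs the trace terms cancel in the sum over outcomes.
Since E†† = E, measuring M after E† ⊗ id gives the POVM with elements (E ⊗ id)(M_x).

Upper bound: the comparison map E† ∘ Δ yields exactly the dephased elements Δ((E ⊗ id)(M_x)).
Coherence is homogeneous, so each term is at most tr M_x · C_g(E), and the traces sum to the total
dimension.

Lower bound: the adjoint of a detection-incoherent map preserves incoherence, so every such
comparison costs at least the average coherence of the (E ⊗ id)(M_x). The m cyclic ancilla shifts of
an incoherent state σ fit into one incoherent POVM and all have the same coherence after E ⊗ id. The
normalization 1/(dm) then leaves 1/d. -/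

set_option linter.unusedSectionVars false

noncomputable section

namespace CoheringPower

open Matrix
open scoped ComplexOrder

/-! ### Coherence and relative entropy to incoherent operators. -/

section Entropy

theorem dephase_apply {ι : Type*} [DecidableEq ι] (X : Matrix ι ι ℂ) : dephase X = diagonal fun i => X i i := rfl

theorem ofReal_re_diag {ι : Type*} {X : Matrix ι ι ℂ} (hX : X.PosSemidef) (i : ι) :
    (((X i i).re : ℝ) : ℂ) = X i i :=
  Complex.ext rfl (Complex.nonneg_iff.1 (hX.diag_nonneg (i := i))).2

variable {ι κ : Type*} [Fintype ι] [DecidableEq ι] [Fintype κ] [DecidableEq κ]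

/-- The spectrum is finite, so the functional calculus applies even to `Real.log` at 0. -/
theorem continuousOn_real_spectrum (X : Matrix ι ι ℂ) (f : ℝ → ℝ) :
    ContinuousOn f (spectrum ℝ X) :=
  X.finite_real_spectrum.continuousOn f

/-- The relative entropy between a positive operator and its dephased version. -/
def coherence (X : Matrix ι ι ℂ) : ℝ :=
  ((cfc (fun x : ℝ => x * Real.log x) X).trace.re -
    ∑ i, (X i i).re * Real.log (X i i).re) / Real.log 2

theorem isIncoherent_iff {X : Matrix ι ι ℂ} :
    IsIncoherent X ↔ ∀ i j, i ≠ j → X i j = 0 := by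
  rw [IsIncoherent, dephase_apply]
  constructor
  · intro h i j hij
    rw [← h, diagonal_apply_ne _ hij]
  · intro h
    ext i j
    by_cases hij : i = j
    · subst hij; simp
    · rw [diagonal_apply_ne _ hij, h i j hij]

theorem mul_cfc_log {X : Matrix ι ι ℂ} (hX : X.IsHermitian) :
    X * cfc Real.log X = cfc (fun x : ℝ => x * Real.log x) X := by
  have hX' : IsSelfAdjoint X := hX
  rw [cfc_mul (fun x : ℝ => x) Real.log X (continuousOn_real_spectrum X _)
    (continuousOn_real_spectrum X _), cfc_id' ℝ X hX']

/-- Reindexing a matrix along a permutation of the basis, as a star algebra homomorphism. -/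
def submatrixStarAlgHom (e : κ ≃ ι) : Matrix ι ι ℂ →⋆ₐ[ℝ] Matrix κ κ ℂ where
  toFun X := X.submatrix e e
  map_one' := by simp
  map_mul' X Y := (submatrix_mul_equiv X Y e e e).symm
  map_zero' := rfl
  map_add' _ _ := rfl
  commutes' r := by
    ext i j
    simp [algebraMap_matrix_apply]
  map_star' _ := rfl

theorem cfc_submatrix (f : ℝ → ℝ) {X : Matrix ι ι ℂ} (hX : X.IsHermitian) (e : κ ≃ ι) :
    cfc f (X.submatrix e e) = (cfc f X).submatrix e e := by
  have hX' : IsSelfAdjoint X := hX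
  have hX'' : IsSelfAdjoint (X.submatrix e e) := hX.submatrix e
  exact ((submatrixStarAlgHom e).map_cfc (S := ℝ) f X (continuousOn_real_spectrum X f)
    (continuous_id.matrix_submatrix e e) hX' hX'').symm

/-- Diagonal matrices, as a star algebra homomorphism. -/
def diagonalStarAlgHom : (ι → ℂ) →⋆ₐ[ℝ] Matrix ι ι ℂ where
  toFun v := diagonal v
  map_one' := diagonal_one
  map_mul' v w := (diagonal_mul_diagonal v w).symm
  map_zero' := diagonal_zero
  map_add' v w := (diagonal_add v w).symm
  commutes' r := by
    ext i j
    simp [algebraMap_matrix_apply, diagonal_apply]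
  map_star' v := (diagonal_conjTranspose v).symm

/-- On matrices the functional calculus is evaluation of an interpolating polynomial, which can be
chosen to agree with the function on any further finite set. -/
theorem exists_aeval_eq_cfc (f : ℝ → ℝ) {X : Matrix ι ι ℂ} (hX : X.IsHermitian) (s : Finset ℝ) :
    ∃ p : Polynomial ℝ, (∀ x ∈ s, p.eval x = f x) ∧ cfc f X = Polynomial.aeval X p := by
  have hX' : IsSelfAdjoint X := hX
  let t := X.finite_real_spectrum.toFinset ∪ s
  refine ⟨Lagrange.interpolate t id f, ?_, ?_⟩
  · intro x hx
    exact Lagrange.eval_interpolate_at_node f (Function.injective_id.injOn)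
      (Finset.mem_union_right _ hx)
  · rw [← cfc_polynomial _ X hX']
    refine cfc_congr fun x hx => ?_
    exact (Lagrange.eval_interpolate_at_node f (Function.injective_id.injOn)
      (Finset.mem_union_left s (by simpa using hx))).symm

theorem cfc_diagonal_ofReal (f : ℝ → ℝ) (y : ι → ℝ) :
    cfc f (diagonal fun i => (y i : ℂ)) = diagonal fun i => (f (y i) : ℂ) := by
  have h : (diagonal fun i => (y i : ℂ)).IsHermitian := by
    rw [IsHermitian, diagonal_conjTranspose]; congr 1; ext i; simp
  obtain ⟨p, hp, hf⟩ := exists_aeval_eq_cfc f h (Finset.univ.image y)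
  rw [hf]
  have := Polynomial.aeval_algHom_apply (diagonalStarAlgHom (ι := ι)).toAlgHom
    (fun i => (y i : ℂ)) p
  refine this.trans ?_
  change diagonal _ = _
  congr 1
  ext i
  have h2 := Polynomial.aeval_algHom_apply (Pi.evalAlgHom ℝ (fun _ : ι => ℂ) i)
    (fun i => (y i : ℂ)) p
  refine h2.symm.trans ?_
  change Polynomial.aeval (algebraMap ℝ ℂ (y i)) p = _
  rw [Polynomial.aeval_algebraMap_apply, Polynomial.coe_aeval_eq_eval, hp _ (by simp)]
  rfl

/-- Diagonal entries of the functional calculus are averages over the spectrum, with doubly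
stochastic weights. -/
theorem exists_doublyStochastic_cfc {X : Matrix ι ι ℂ} (hX : X.IsHermitian) :
    ∃ w : ι → ι → ℝ, (∀ i k, 0 ≤ w i k) ∧ (∀ i, ∑ k, w i k = 1) ∧
      ∀ (f : ℝ → ℝ) i, ((cfc f X) i i) = ((∑ k, w i k * f (hX.eigenvalues k) : ℝ) : ℂ) := by
  -- The weights are |U_ik|² for the eigenvector unitary U; each row sums to 1 because U U* = 1.
  refine ⟨fun i k => Complex.normSq ((hX.eigenvectorUnitary : Matrix ι ι ℂ) i k),
    fun i k => Complex.normSq_nonneg _, ?_, ?_⟩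
  · intro i
    have h := Unitary.mul_star_self_of_mem hX.eigenvectorUnitary.2
    have h2 := congrFun (congrFun h i) i
    rw [mul_apply] at h2
    simp only [star_eq_conjTranspose, conjTranspose_apply, one_apply_eq, RCLike.star_def,
      Complex.mul_conj] at h2
    exact_mod_cast h2
  · intro f i
    rw [hX.cfc_eq, IsHermitian.cfc, Unitary.conjStarAlgAut_apply, mul_apply]
    push_cast
    refine Finset.sum_congr rfl fun k _ => ?_
    rw [mul_diagonal, star_eq_conjTranspose, conjTranspose_apply, RCLike.star_def,
      ← Complex.mul_conj]
    simp only [Function.comp_apply, Complex.coe_algebraMap, RCLike.ofReal]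
    ring

/-- Jensen's inequality for the spectral weights. -/
theorem map_diag_le_cfc_of_convexOn {f : ℝ → ℝ} (hf : ConvexOn ℝ (Set.Ici 0) f)
    {X : Matrix ι ι ℂ} (hX : X.PosSemidef) (i : ι) : f (X i i).re ≤ (cfc f X i i).re := by
  obtain ⟨w, hw, hw1, h⟩ := exists_doublyStochastic_cfc hX.isHermitian
  have hX' : IsSelfAdjoint X := hX.isHermitian
  have h1 := h id i
  rw [cfc_id ℝ X hX'] at h1
  rw [h f i, h1, Complex.ofReal_re, Complex.ofReal_re]
  have := hf.map_sum_le (t := Finset.univ) (w := w i) (p := hX.isHermitian.eigenvalues)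
    (fun k _ => hw i k) (hw1 i) (fun k _ => hX.eigenvalues_nonneg k)
  simpa using this

theorem coherence_nonneg {X : Matrix ι ι ℂ} (hX : X.PosSemidef) : 0 ≤ coherence X := by
  refine div_nonneg (sub_nonneg.2 ?_) (Real.log_nonneg one_le_two)
  rw [trace, Complex.re_sum]
  exact Finset.sum_le_sum fun i _ => map_diag_le_cfc_of_convexOn Real.convexOn_mul_log hX i

theorem coherence_submatrix {X : Matrix ι ι ℂ} (hX : X.IsHermitian) (e : κ ≃ ι) :
    coherence (X.submatrix e e) = coherence X := by
  have h1 (Y : Matrix ι ι ℂ) : (Y.submatrix e e).trace = Y.trace :=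
    Equiv.sum_comp e fun i => Y i i
  rw [coherence, coherence, cfc_submatrix _ hX, h1]
  congr 2
  exact Equiv.sum_comp e fun i => (X i i).re * Real.log (X i i).re

/-- The extra term (t log t) tr X produced by scaling x log x appears in both halves of the
coherence and cancels. -/
theorem coherence_smul {X : Matrix ι ι ℂ} (hX : X.IsHermitian) (t : ℝ) :
    coherence (t • X) = t * coherence X := by
  have hX' : IsSelfAdjoint X := hX
  have hs (x : ℝ) : (t * x) * Real.log (t * x) = (t * Real.log t) * x + t * (x * Real.log x) := by
    by_cases ht : t = 0
    · simp [ht]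
    by_cases hx : x = 0
    · simp [hx]
    rw [Real.log_mul ht hx]; ring
  have h1 : cfc (fun x : ℝ => x * Real.log x) (t • X) =
      (t * Real.log t) • X + t • cfc (fun x : ℝ => x * Real.log x) X := by
    rw [← cfc_comp_const_mul t _ X ((X.finite_real_spectrum.image _).continuousOn _) hX']
    simp only [hs]
    rw [cfc_add X (fun x => t * Real.log t * x) (fun x => t * (x * Real.log x))
        (continuousOn_real_spectrum X _) (continuousOn_real_spectrum X _),
      cfc_const_mul _ _ _ (continuousOn_real_spectrum X _),
      cfc_const_mul _ _ _ (continuousOn_real_spectrum X _), cfc_id' ℝ X hX']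
  rw [coherence, coherence, h1]
  simp only [Matrix.smul_apply, Complex.smul_re, smul_eq_mul, hs, Finset.sum_add_distrib,
    ← Finset.mul_sum, trace_add, trace_smul, Complex.add_re]
  simp only [trace, Complex.re_sum, diag_apply]
  ring

theorem IsIncoherent.eq_diagonal {Y : Matrix ι ι ℂ} (hY : IsIncoherent Y) (hp : Y.PosSemidef) :
    Y = diagonal fun i => (((Y i i).re : ℝ) : ℂ) := by
  conv_lhs => rw [← hY, dephase_apply]
  congr 1
  ext i
  exact (ofReal_re_diag hp i).symm

theorem trace_mul_cfc_log_of_isIncoherent (X : Matrix ι ι ℂ) {Y : Matrix ι ι ℂ}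
    (hY : Y.PosSemidef) (hY' : IsIncoherent Y) :
    (X * cfc Real.log Y).trace.re = ∑ i, (X i i).re * Real.log (Y i i).re := by
  rw [hY'.eq_diagonal hY, cfc_diagonal_ofReal, trace, Complex.re_sum]
  refine Finset.sum_congr rfl fun i _ => ?_
  rw [diag_apply, mul_diagonal, Complex.re_mul_ofReal, diagonal_apply_eq, Complex.ofReal_re]

/-- A vanishing diagonal entry of a positive semidefinite matrix kills its whole column. This makes
D(X‖Δ(X)) finite. -/
theorem mulVec_eq_zero_of_diag {X : Matrix ι ι ℂ} (hX : X.PosSemidef) {v : ι → ℂ}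
    (h : ∀ i, X i i * v i = 0) : X *ᵥ v = 0 := by
  have hcol (i : ι) (hi : X i i = 0) : X *ᵥ Pi.single i 1 = 0 := by
    rw [← hX.dotProduct_mulVec_zero_iff]
    simp [hi]
  ext j
  rw [mulVec, dotProduct]
  refine Finset.sum_eq_zero fun i _ => ?_
  rcases mul_eq_zero.1 (h i) with h0 | h0
  · have := congrFun (hcol i h0) j
    rw [mulVec_single_one] at this
    simp only [col_apply, Pi.zero_apply] at this
    rw [this, zero_mul]
  · rw [h0, mul_zero]

theorem isIncoherent_dephase (X : Matrix ι ι ℂ) : IsIncoherent (dephase X) := by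
  rw [isIncoherent_iff]
  intro i j hij
  rw [dephase_apply, diagonal_apply_ne _ hij]

theorem posSemidef_dephase {X : Matrix ι ι ℂ} (hX : X.PosSemidef) : (dephase X).PosSemidef := by
  rw [dephase_apply]
  exact PosSemidef.diagonal fun i => hX.diag_nonneg

theorem relEntropy_dephase {X : Matrix ι ι ℂ} (hX : X.PosSemidef) :
    relEntropy X (dephase X) = (coherence X : EReal) := by
  rw [relEntropy, if_pos, mul_cfc_log hX.isHermitian,
    trace_mul_cfc_log_of_isIncoherent X (posSemidef_dephase hX) (isIncoherent_dephase X),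
    coherence]
  · simp [dephase_apply]
  · intro v hv
    refine mulVec_eq_zero_of_diag hX fun i => ?_
    have := congrFun hv i
    rwa [dephase_apply, mulVec_diagonal] at this

/-- This is 1 − 1/u ≤ log u at u = x/y, multiplied by x. -/
theorem sub_le_mul_log_sub_mul_log {x y : ℝ} (hx : 0 ≤ x) (hy : 0 ≤ y) (h : y = 0 → x = 0) :
    x - y ≤ x * Real.log x - x * Real.log y := by
  rcases hx.eq_or_lt with rfl | hx
  · simpa using hy
  have hy' : 0 < y := hy.lt_of_ne fun h0 => hx.ne' (h h0.symm)
  have := Real.one_sub_inv_le_log_of_pos (div_pos hx hy')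
  rw [Real.log_div hx.ne' hy'.ne', inv_div] at this
  have := mul_le_mul_of_nonneg_left this hx.le
  rw [mul_sub, mul_one, mul_div_cancel₀ _ hx.ne', mul_sub] at this
  exact this

/-- Among the incoherent operators, the relative entropy is smallest at the dephased operator, up
to the difference of the traces. -/
theorem coherence_add_le_relEntropy {X Y : Matrix ι ι ℂ} (hX : X.PosSemidef) (hY : Y.PosSemidef)
    (hY' : IsIncoherent Y) :
    ((coherence X + (X.trace.re - Y.trace.re) / Real.log 2 : ℝ) : EReal) ≤ relEntropy X Y := by
  rw [relEntropy]
  split_ifs with h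
  · rw [EReal.coe_le_coe_iff, mul_cfc_log hX.isHermitian,
      trace_mul_cfc_log_of_isIncoherent X hY hY', coherence, ← add_div]
    refine div_le_div_of_nonneg_right ?_ (Real.log_nonneg one_le_two)
    have key : ∑ i, ((X i i).re - (Y i i).re) ≤
        ∑ i, ((X i i).re * Real.log (X i i).re - (X i i).re * Real.log (Y i i).re) := by
      refine Finset.sum_le_sum fun i _ => sub_le_mul_log_sub_mul_log
        (Complex.nonneg_iff.1 hX.diag_nonneg).1 (Complex.nonneg_iff.1 hY.diag_nonneg).1 fun h0 => ?_
      -- A zero diagonal entry of Y puts a basis vector in its kernel, so the support condition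
      -- makes that entry of X vanish too.
      have hv : Y *ᵥ Pi.single i 1 = 0 := by
        rw [hY'.eq_diagonal hY]
        ext j
        rw [mulVec_diagonal]
        by_cases hj : j = i
        · subst hj; simp [h0]
        · simp [hj]
      have := congrFun (h _ hv) i
      rw [mulVec_single_one] at this
      simp only [col_apply, Pi.zero_apply] at this
      rw [this, Complex.zero_re]
    simp only [Finset.sum_sub_distrib] at key
    simp only [trace, Complex.re_sum, diag_apply] at key ⊢
    linarith
  · exact le_top

theorem cohRelEntropy_eq_coherence {ρ : Matrix ι ι ℂ} (hρ : IsState ρ) :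
    cohRelEntropy ρ = (coherence ρ : EReal) := by
  apply le_antisymm
  · rw [← relEntropy_dephase hρ.posSemidef]
    refine iInf₂_le _ ⟨⟨posSemidef_dephase hρ.posSemidef, ?_⟩, isIncoherent_dephase ρ⟩
    rw [dephase_apply, trace_diagonal]
    exact hρ.trace_eq_one
  · refine le_iInf₂ fun σ hσ => ?_
    have := coherence_add_le_relEntropy hρ.posSemidef hσ.1.posSemidef hσ.2
    rwa [hρ.trace_eq_one, hσ.1.trace_eq_one, sub_self, zero_div, add_zero] at this

end Entropy

/-! ### Adjoints, positivity, and block structure of ampliated maps. -/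

section Adjoint

variable {ι κ : Type*} [Fintype ι] [DecidableEq ι] [Fintype κ] [DecidableEq κ]

theorem eq_adjointMap {Φ Ψ : SuperOp ι}
    (h : ∀ X Y, (Xᴴ * Ψ Y).trace = ((Φ X)ᴴ * Y).trace) : Ψ = adjointMap Φ := by
  refine LinearMap.ext fun Y => ?_
  rw [← sub_eq_zero, ← trace_conjTranspose_mul_self_eq_zero_iff, Matrix.mul_sub, trace_sub, h,
    trace_conjTranspose_mul_adjointMap, sub_self]

theorem trace_conjTranspose_mul_comm (X Y : Matrix ι ι ℂ) :
    (Xᴴ * Y).trace = star (Yᴴ * X).trace := by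
  rw [← trace_conjTranspose, conjTranspose_mul, conjTranspose_conjTranspose]

theorem adjointMap_adjointMap (Φ : SuperOp ι) : adjointMap (adjointMap Φ) = Φ :=
  (eq_adjointMap fun X Y => by
    rw [trace_conjTranspose_mul_comm, ← trace_conjTranspose_mul_adjointMap,
      ← trace_conjTranspose_mul_comm]).symm

theorem adjointMap_comp (Φ Ψ : SuperOp ι) :
    adjointMap (Φ ∘ₗ Ψ) = adjointMap Ψ ∘ₗ adjointMap Φ :=
  (eq_adjointMap fun X Y => by
    rw [LinearMap.comp_apply, trace_conjTranspose_mul_adjointMap,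
      trace_conjTranspose_mul_adjointMap, LinearMap.comp_apply]).symm

theorem adjointMap_dephase : adjointMap (dephase : SuperOp ι) = dephase :=
  (eq_adjointMap fun X Y => by
    rw [dephase_apply, dephase_apply, diagonal_conjTranspose]
    simp [trace, mul_diagonal, diagonal_mul]).symm

theorem dephase_comp_dephase : (dephase : SuperOp ι) ∘ₗ dephase = dephase :=
  LinearMap.ext fun X => isIncoherent_dephase X

/-- The block `X_{ab}` of an operator `X = ∑ X_{ab} ⊗ |a⟩⟨b|`. -/
def block {ι κ : Type*} (X : Matrix (ι × κ) (ι × κ) ℂ) (a b : κ) : Matrix ι ι ℂ :=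
  Matrix.of fun i j => X (i, a) (j, b)

theorem block_ampliate (Φ : SuperOp ι) (X : Matrix (ι × κ) (ι × κ) ℂ) (a b : κ) :
    block (ampliate κ Φ X) a b = Φ (block X a b) := rfl

theorem trace_conjTranspose_mul_eq_sum_block (X Y : Matrix (ι × κ) (ι × κ) ℂ) :
    (Xᴴ * Y).trace = ∑ a, ∑ b, ((block X a b)ᴴ * block Y a b).trace := by
  simp only [trace, diag_apply, mul_apply, conjTranspose_apply, block, of_apply,
    Fintype.sum_prod_type]
  rw [Finset.sum_comm]
  conv_rhs => rw [Finset.sum_comm]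
  refine Finset.sum_congr rfl fun b _ => ?_
  conv_rhs => rw [Finset.sum_comm]
  exact Finset.sum_congr rfl fun j _ => Finset.sum_comm

theorem adjointMap_ampliate (Φ : SuperOp ι) :
    adjointMap (ampliate κ Φ) = ampliate κ (adjointMap Φ) :=
  (eq_adjointMap fun X Y => by
    simp only [trace_conjTranspose_mul_eq_sum_block, block_ampliate,
      trace_conjTranspose_mul_adjointMap]).symm

theorem trace_ampliate {Φ : SuperOp ι} (h : ∀ X, (Φ X).trace = X.trace)
    (X : Matrix (ι × κ) (ι × κ) ℂ) : (ampliate κ Φ X).trace = X.trace := by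
  have key (Z : Matrix (ι × κ) (ι × κ) ℂ) : Z.trace = ∑ a, (block Z a a).trace := by
    simp only [trace, diag_apply, block, of_apply, Fintype.sum_prod_type]
    exact Finset.sum_comm
  simp only [key, block_ampliate, h]

theorem adjointMap_one {Φ : SuperOp ι} (h : ∀ X, (Φ X).trace = X.trace) :
    adjointMap Φ 1 = 1 := by
  rw [← sub_eq_zero, ← trace_conjTranspose_mul_self_eq_zero_iff, Matrix.mul_sub, trace_sub,
    trace_conjTranspose_mul_adjointMap, Matrix.mul_one, Matrix.mul_one, trace_conjTranspose,
    trace_conjTranspose, h, sub_self]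

theorem trace_adjointMap {Φ : SuperOp ι} (h : Φ 1 = 1) (X : Matrix ι ι ℂ) :
    (adjointMap Φ X).trace = X.trace := by
  have := trace_conjTranspose_mul_adjointMap Φ 1 X
  rwa [h, conjTranspose_one, Matrix.one_mul, Matrix.one_mul] at this

theorem trace_mul_nonneg {X Y : Matrix ι ι ℂ} (hX : X.PosSemidef) (hY : Y.PosSemidef) :
    0 ≤ (X * Y).trace := by
  obtain ⟨n, v, rfl⟩ := posSemidef_iff_eq_sum_vecMulVec.1 hX
  rw [Finset.sum_mul, trace_sum]
  refine Finset.sum_nonneg fun i _ => ?_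
  rw [vecMulVec_mul, trace_vecMulVec, dotProduct_comm, ← dotProduct_mulVec]
  exact hY.dotProduct_mulVec_nonneg _

/-- Over ℂ, a real quadratic form already forces X to be Hermitian. -/
theorem posSemidef_of_dotProduct_mulVec_nonneg {X : Matrix ι ι ℂ}
    (h : ∀ v : ι → ℂ, 0 ≤ star v ⬝ᵥ (X *ᵥ v)) : X.PosSemidef := by
  rw [← isPositive_toEuclideanLin_iff, LinearMap.isPositive_iff_complex]
  intro v
  have hv := Complex.nonneg_iff.1 (h v.ofLp)
  have hstar : inner ℂ (X.toEuclideanLin v) v = star (star v.ofLp ⬝ᵥ (X *ᵥ v.ofLp)) := by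
    rw [EuclideanSpace.inner_eq_star_dotProduct, dotProduct_comm, star_dotProduct]
    rfl
  rw [hstar]
  exact ⟨Complex.ext rfl (by simp [← hv.2]), hv.1⟩

/-- Testing on v gives ⟨v, Φ†(Y) v⟩ = tr(Φ(vv*) Y), the trace of a product of positive operators. -/
theorem posSemidef_adjointMap {Φ : SuperOp ι} (h : ∀ X, X.PosSemidef → (Φ X).PosSemidef)
    {Y : Matrix ι ι ℂ} (hY : Y.PosSemidef) : (adjointMap Φ Y).PosSemidef := by
  refine posSemidef_of_dotProduct_mulVec_nonneg fun v => ?_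
  have hv := posSemidef_vecMulVec_self_star v
  have h1 := trace_conjTranspose_mul_adjointMap Φ (vecMulVec v (star v)) Y
  rw [hv.isHermitian.eq, (h _ hv).isHermitian.eq, vecMulVec_mul, trace_vecMulVec,
    dotProduct_comm, ← dotProduct_mulVec] at h1
  rw [h1]
  exact trace_mul_nonneg (h _ hv) hY

theorem IsCompletelyPositive.comp {Φ Ψ : SuperOp ι} (hΦ : IsCompletelyPositive Φ)
    (hΨ : IsCompletelyPositive Ψ) : IsCompletelyPositive (Φ ∘ₗ Ψ) :=
  fun k X hX => hΦ k _ (hΨ k X hX)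

theorem IsCompletelyPositive.adjointMap {Φ : SuperOp ι} (hΦ : IsCompletelyPositive Φ) :
    IsCompletelyPositive (adjointMap Φ) := by
  intro k X hX
  rw [← adjointMap_ampliate]
  exact posSemidef_adjointMap (hΦ k) hX

theorem isCompletelyPositive_dephase : IsCompletelyPositive (dephase : SuperOp ι) := by
  intro k X hX
  -- Dephasing the system is Schur multiplication by the Gram matrix `Cᴴ * C`, whose entries are 1
  -- when the system indices agree and 0 otherwise; the Schur product theorem then applies.
  let C : Matrix ι (ι × Fin k) ℂ := Matrix.of fun l p => if l = p.1 then 1 else 0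
  have h := hX.hadamard (posSemidef_conjTranspose_mul_self C)
  have h2 : ampliate (Fin k) dephase X = X ⊙ (Cᴴ * C) := by
    ext ⟨i, a⟩ ⟨j, b⟩
    simp only [ampliate, LinearMap.coe_mk, AddHom.coe_mk, of_apply, dephase_apply, diagonal_apply,
      hadamard_apply, mul_apply, conjTranspose_apply, C]
    by_cases hij : i = j
    · subst hij; simp
    · simp [hij, Ne.symm hij]
  rwa [h2]

/-- Unitality of E is trace preservation of E†, and detection incoherence is idempotence of Δ. -/
theorem isDIO_adjointMap_comp_dephase {E : SuperOp ι} (hE : IsChannel E) (hu : IsUnital E) :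
    IsDIO (adjointMap E ∘ₗ dephase) := by
  refine ⟨⟨hE.completelyPositive.adjointMap.comp isCompletelyPositive_dephase, fun X => ?_⟩, ?_⟩
  · rw [LinearMap.comp_apply, trace_adjointMap hu, dephase_apply, trace_diagonal]
    rfl
  · simp only [LinearMap.comp_assoc, dephase_comp_dephase]

/-- Taking adjoints in Δ ∘ F = Δ ∘ F ∘ Δ gives F† ∘ Δ = Δ ∘ F† ∘ Δ. -/
theorem IsDIO.isIncoherent_adjointMap {F : SuperOp ι} (hF : IsDIO F) {X : Matrix ι ι ℂ}
    (hX : IsIncoherent X) : IsIncoherent (adjointMap F X) := by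
  have h := congrArg adjointMap hF.2
  simp only [adjointMap_comp, adjointMap_dephase] at h
  have h2 := LinearMap.congr_fun h X
  simp only [LinearMap.comp_apply, show dephase X = X from hX] at h2
  exact h2.symm

theorem block_eq_zero {X : Matrix (ι × κ) (ι × κ) ℂ} (hX : IsIncoherent X) {a b : κ}
    (hab : a ≠ b) : block X a b = 0 := by
  ext i j
  exact isIncoherent_iff.1 hX _ _ fun h => hab (congrArg Prod.snd h)

theorem isIncoherent_block {X : Matrix (ι × κ) (ι × κ) ℂ} (hX : IsIncoherent X) (a b : κ) :
    IsIncoherent (block X a b) :=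
  isIncoherent_iff.2 fun _ _ hij =>
    isIncoherent_iff.1 hX _ _ fun h => hij (congrArg Prod.fst h)

theorem isIncoherent_ampliate {Φ : SuperOp ι} (h : ∀ X, IsIncoherent X → IsIncoherent (Φ X))
    {X : Matrix (ι × κ) (ι × κ) ℂ} (hX : IsIncoherent X) : IsIncoherent (ampliate κ Φ X) := by
  refine isIncoherent_iff.2 fun p q hpq => ?_
  change Φ (block X p.2 q.2) p.1 q.1 = 0
  by_cases h2 : p.2 = q.2
  · exact isIncoherent_iff.1 (h _ (isIncoherent_block hX _ _)) _ _ fun h1 => hpq (Prod.ext h1 h2)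
  · rw [block_eq_zero hX h2, map_zero, Matrix.zero_apply]

/-- On the image of an incoherent operator, dephasing the system dephases the composite system. -/
theorem ampliate_dephase_comp (Φ : SuperOp ι) {X : Matrix (ι × κ) (ι × κ) ℂ}
    (hX : IsIncoherent X) :
    ampliate κ (dephase ∘ₗ Φ) X = dephase (ampliate κ Φ X) := by
  ext ⟨i, a⟩ ⟨j, b⟩
  change dephase (Φ (block X a b)) i j = _
  rw [dephase_apply, dephase_apply, diagonal_apply, diagonal_apply]
  by_cases hab : a = b
  · subst hab
    by_cases hij : i = j
    · subst hij; simp; rfl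
    · simp [hij]
  · simp [block_eq_zero hX hab, hab]

end Adjoint

/-! ### The upper bound. -/

section Inequalities

variable {ι : Type*} [Fintype ι] [DecidableEq ι]

theorem coe_sum_ereal {α : Type*} (s : Finset α) (f : α → ℝ) :
    ((∑ a ∈ s, f a : ℝ) : EReal) = ∑ a ∈ s, (f a : EReal) :=
  map_sum (⟨⟨Real.toEReal, rfl⟩, EReal.coe_add⟩ : ℝ →+ EReal) f s

theorem IsChannel.isState_ampliate {E : SuperOp ι} (hE : IsChannel E) {m : ℕ}
    {σ : Matrix (ι × Fin m) (ι × Fin m) ℂ} (hσ : IsState σ) : IsState (ampliate (Fin m) E σ) :=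
  ⟨hE.completelyPositive m σ hσ.posSemidef,
    (trace_ampliate hE.tracePreserving σ).trans hσ.trace_eq_one⟩

theorem precomp_ampliate_adjointMap (E : SuperOp ι) {m n : ℕ}
    (M : Fin n → Matrix (ι × Fin m) (ι × Fin m) ℂ) (x : Fin n) :
    precomp M (ampliate (Fin m) (adjointMap E)) x = ampliate (Fin m) E (M x) := by
  rw [precomp, adjointMap_ampliate, adjointMap_adjointMap]

theorem coherence_le_stateCoheringPower {E : SuperOp ι} (hE : IsChannel E) {m : ℕ} (hm : 0 < m)
    {σ : Matrix (ι × Fin m) (ι × Fin m) ℂ} (hσ : IsIncoherentState σ) :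
    (coherence (ampliate (Fin m) E σ) : EReal) ≤ stateCoheringPower E := by
  rw [← cohRelEntropy_eq_coherence (hE.isState_ampliate hσ.1)]
  exact le_iSup_of_le m (le_iSup_of_le hm (le_iSup₂_of_le σ hσ le_rfl))

/-- Homogeneity reduces to the normalized state X / tr X; a positive operator of trace zero is zero
and is treated apart. -/
theorem coherence_ampliate_le_trace_mul {E : SuperOp ι} (hE : IsChannel E) {c : ℝ}
    (hc : stateCoheringPower E ≤ c) {m : ℕ} (hm : 0 < m)
    {X : Matrix (ι × Fin m) (ι × Fin m) ℂ} (hX : X.PosSemidef) (hX' : IsIncoherent X) :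
    coherence (ampliate (Fin m) E X) ≤ X.trace.re * c := by
  have htr := Complex.nonneg_iff.1 hX.trace_nonneg
  have htr' : (X.trace.re : ℂ) = X.trace := Complex.ext rfl htr.2
  rcases htr.1.eq_or_lt with h0 | hpos
  · have : X = 0 := by rw [← hX.trace_eq_zero_iff, ← htr', ← h0, Complex.ofReal_zero]
    subst this
    have := coherence_smul (X := (0 : Matrix (ι × Fin m) (ι × Fin m) ℂ)) isHermitian_zero 0
    rw [zero_smul, zero_mul] at this
    rw [map_zero, this, trace_zero, Complex.zero_re, zero_mul]
  · set t := X.trace.re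
    have hσ : IsIncoherentState (t⁻¹ • X) := by
      refine ⟨⟨hX.smul (inv_nonneg.2 hpos.le), ?_⟩, ?_⟩
      · rw [trace_smul, ← htr', Complex.real_smul, ← Complex.ofReal_mul, inv_mul_cancel₀ hpos.ne',
          Complex.ofReal_one]
      · rw [IsIncoherent, LinearMap.map_smul_of_tower, show dephase X = X from hX']
    have h1 := (coherence_le_stateCoheringPower hE hm hσ).trans hc
    rw [EReal.coe_le_coe_iff, LinearMap.map_smul_of_tower,
      coherence_smul (hE.completelyPositive m X hX).isHermitian, inv_mul_le_iff₀ hpos] at h1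
    exact h1

theorem sum_trace_re_eq {n : ℕ} {N : Fin n → Matrix ι ι ℂ} (h : ∑ x, N x = 1) :
    ∑ x, (N x).trace.re = Fintype.card ι := by
  rw [← Complex.re_sum, ← trace_sum, h, trace_one, Complex.natCast_re]

theorem measCoheringPower_adjointMap_le [Nonempty ι] {E : SuperOp ι} (hE : IsChannel E)
    (hu : IsUnital E) : measCoheringPower (adjointMap E) ≤ stateCoheringPower E := by
  rcases eq_or_ne (stateCoheringPower E) ⊤ with htop | htop
  · rw [htop]; exact le_top
  -- Any one incoherent state excludes −∞, so the supremum is a real number c and the estimates can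
  -- be made in ℝ.
  have hbot : stateCoheringPower E ≠ ⊥ := by
    obtain ⟨i⟩ := ‹Nonempty ι›
    have hσ : IsIncoherentState (diagonal (Pi.single (i, 0) 1) :
        Matrix (ι × Fin 1) (ι × Fin 1) ℂ) := by
      refine ⟨⟨PosSemidef.diagonal ?_, ?_⟩, ?_⟩
      · rw [Pi.single_nonneg]; exact zero_le_one
      · rw [trace_diagonal, Finset.sum_pi_single']; simp
      · exact isIncoherent_iff.2 fun _ _ hij => diagonal_apply_ne _ hij
    exact ne_bot_of_le_ne_bot (EReal.coe_ne_bot _)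
      (coherence_le_stateCoheringPower hE zero_lt_one hσ)
  obtain ⟨c, hc⟩ : ∃ c : ℝ, (c : EReal) = stateCoheringPower E :=
    ⟨_, EReal.coe_toReal htop hbot⟩
  refine iInf₂_le_of_le _ (isDIO_adjointMap_comp_dephase hE hu) ?_
  refine iSup_le fun m => iSup_le fun hm => iSup_le fun n => iSup₂_le fun M hM => ?_
  have hcard : (0 : ℝ) < Fintype.card (ι × Fin m) := by
    have : Nonempty (Fin m) := ⟨⟨0, hm⟩⟩
    exact_mod_cast Fintype.card_pos
  have hx (x : Fin n) : relEntropy (precomp M (ampliate (Fin m) (adjointMap E)) x)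
      (precomp M (ampliate (Fin m) (adjointMap E ∘ₗ dephase)) x) =
        (coherence (ampliate (Fin m) E (M x)) : EReal) := by
    rw [precomp_ampliate_adjointMap, precomp, adjointMap_ampliate, adjointMap_comp,
      adjointMap_adjointMap, adjointMap_dephase, ampliate_dephase_comp E (hM.2 x),
      relEntropy_dephase (hE.completelyPositive m _ (hM.1.posSemidef x))]
  rw [measRelEntropy, Finset.sum_congr rfl fun x _ => hx x, ← coe_sum_ereal, ← EReal.coe_mul, ← hc,
    EReal.coe_le_coe_iff, one_div, inv_mul_le_iff₀ hcard, ← sum_trace_re_eq hM.1.sum_eq_one,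
    Finset.sum_mul]
  exact Finset.sum_le_sum fun x _ =>
    coherence_ampliate_le_trace_mul hE hc.ge hm (hM.1.posSemidef x) (hM.2 x)

/-! ### The lower bound. -/

/-- For a detection-incoherent comparison map, the measurement relative entropy is at least the
average coherence of the transformed POVM elements. -/
theorem sum_coherence_le_measRelEntropy {E F : SuperOp ι} (hE : IsChannel E)
    (hF : IsDIO F) {m n : ℕ} {M : Fin n → Matrix (ι × Fin m) (ι × Fin m) ℂ}
    (hM : IsIncoherentMeasurement M) :
    ((1 / (Fintype.card (ι × Fin m) : ℝ) * ∑ x, coherence (ampliate (Fin m) E (M x)) : ℝ) : EReal) ≤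
      measRelEntropy (precomp M (ampliate (Fin m) (adjointMap E)))
        (precomp M (ampliate (Fin m) F)) := by
  rw [measRelEntropy, EReal.coe_mul]
  refine mul_le_mul_of_nonneg_left ?_ (EReal.coe_nonneg.2 (by positivity))
  -- Both POVMs sum to the identity on traces, so the trace corrections cancel in total, though not
  -- outcome by outcome.
  have hN : ∑ x, (precomp M (ampliate (Fin m) F) x).trace.re =
      ∑ x, (ampliate (Fin m) E (M x)).trace.re := by
    rw [sum_trace_re_eq]
    · simp only [trace_ampliate hE.tracePreserving, sum_trace_re_eq hM.1.sum_eq_one]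
    · simp only [precomp, ← map_sum, hM.1.sum_eq_one]
      exact adjointMap_one (trace_ampliate hF.1.tracePreserving)
  calc ((∑ x, coherence (ampliate (Fin m) E (M x)) : ℝ) : EReal)
      = ((∑ x, (coherence (ampliate (Fin m) E (M x)) + ((ampliate (Fin m) E (M x)).trace.re -
          (precomp M (ampliate (Fin m) F) x).trace.re) / Real.log 2) : ℝ) : EReal) := by
        rw [Finset.sum_add_distrib, ← Finset.sum_div, Finset.sum_sub_distrib, hN, sub_self,
          zero_div, add_zero]
    _ ≤ _ := by
        rw [coe_sum_ereal]
        refine Finset.sum_le_sum fun x _ => ?_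
        rw [precomp_ampliate_adjointMap]
        refine coherence_add_le_relEntropy (hE.completelyPositive m _ (hM.1.posSemidef x))
          (posSemidef_adjointMap (hF.1.completelyPositive m) (hM.1.posSemidef x)) ?_
        rw [precomp, adjointMap_ampliate]
        exact isIncoherent_ampliate (fun _ h => hF.isIncoherent_adjointMap h) (hM.2 x)

/-- The permutation of the product basis that shifts the ancilla cyclically. -/
def ancillaShift (ι : Type*) {m : ℕ} [NeZero m] (k : Fin m) : ι × Fin m ≃ ι × Fin m :=
  (Equiv.refl ι).prodCongr (Equiv.addRight k)

/-- The measurement made of the cyclic shifts of an incoherent state along the ancilla, completed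
by one further outcome. -/
def shiftMeasurement {m : ℕ} [NeZero m] (σ : Matrix (ι × Fin m) (ι × Fin m) ℂ) :
    Fin (m + 1) → Matrix (ι × Fin m) (ι × Fin m) ℂ :=
  Fin.cons (1 - ∑ k, σ.submatrix (ancillaShift ι k) (ancillaShift ι k))
    fun k => σ.submatrix (ancillaShift ι k) (ancillaShift ι k)

theorem IsIncoherent.submatrix {κ : Type*} [Fintype κ] [DecidableEq κ] {X : Matrix ι ι ℂ}
    (hX : IsIncoherent X) (e : κ ≃ ι) : IsIncoherent (X.submatrix e e) :=
  isIncoherent_iff.2 fun _ _ hij => isIncoherent_iff.1 hX _ _ (e.injective.ne hij)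

theorem isIncoherentMeasurement_shiftMeasurement {m : ℕ} [NeZero m]
    {σ : Matrix (ι × Fin m) (ι × Fin m) ℂ} (hσ : IsIncoherentState σ) :
    IsIncoherentMeasurement (shiftMeasurement σ) := by
  have hinc : IsIncoherent (1 - ∑ k, σ.submatrix (ancillaShift ι k) (ancillaShift ι k)) := by
    refine isIncoherent_iff.2 fun p q hpq => ?_
    rw [Matrix.sub_apply, one_apply_ne hpq, Matrix.sum_apply, Finset.sum_eq_zero, sub_zero]
    exact fun k _ => isIncoherent_iff.1 (hσ.2.submatrix _) _ _ hpq
  refine ⟨⟨fun x => ?_, ?_⟩, fun x => ?_⟩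
  · refine Fin.cases ?_ (fun k => ?_) x
    · change (1 - ∑ k, σ.submatrix (ancillaShift ι k) (ancillaShift ι k)).PosSemidef
      rw [← show dephase _ = _ from hinc, dephase_apply]
      refine PosSemidef.diagonal fun p => ?_
      rw [Pi.zero_apply, Matrix.sub_apply, one_apply_eq, Matrix.sum_apply, sub_nonneg]
      -- At a product index with system part i, the shifts run once through the ancilla, so the sum
      -- is the marginal probability of i under σ, at most 1.
      calc ∑ k, σ.submatrix (ancillaShift ι k) (ancillaShift ι k) p p
          = ∑ b, σ (p.1, b) (p.1, b) :=
            Equiv.sum_comp (Equiv.addLeft p.2) fun b => σ (p.1, b) (p.1, b)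
        _ ≤ ∑ i, ∑ b, σ (i, b) (i, b) :=
            Finset.single_le_sum (f := fun i => ∑ b, σ (i, b) (i, b))
              (fun i _ => Finset.sum_nonneg fun b _ => hσ.1.posSemidef.diag_nonneg)
              (Finset.mem_univ p.1)
        _ = 1 := by
            rw [← hσ.1.trace_eq_one, trace, Fintype.sum_prod_type]
            rfl
    · exact hσ.1.posSemidef.submatrix _
  · rw [Fin.sum_univ_succ]
    exact sub_add_cancel _ _
  · refine Fin.cases hinc (fun k => ?_) x
    exact hσ.2.submatrix _

theorem stateCoheringPower_le_measCoheringPower [Nonempty ι] {E : SuperOp ι} (hE : IsChannel E) :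
    ((1 / (Fintype.card ι : ℝ) : ℝ) : EReal) * stateCoheringPower E ≤
      measCoheringPower (adjointMap E) := by
  have hcard : (0 : ℝ) < Fintype.card ι := by exact_mod_cast Fintype.card_pos
  refine le_iInf₂ fun F hF => ?_
  -- Moving the positive factor to the other side leaves a bound on the bare supremum, checked state
  -- by state.
  rw [mul_comm, ← EReal.le_div_iff_mul_le (EReal.coe_pos.2 (by positivity)) (EReal.coe_ne_top _)]
  refine iSup_le fun m => iSup_le fun hm => iSup₂_le fun σ hσ => ?_
  rw [EReal.le_div_iff_mul_le (EReal.coe_pos.2 (by positivity)) (EReal.coe_ne_top _), mul_comm]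
  have : NeZero m := ⟨hm.ne'⟩
  have hM := isIncoherentMeasurement_shiftMeasurement hσ
  refine le_trans ?_ ((sum_coherence_le_measRelEntropy hE hF hM).trans
    (le_iSup_of_le m (le_iSup_of_le hm (le_iSup_of_le (m + 1) (le_iSup₂_of_le _ hM le_rfl)))))
  have hs := hE.isState_ampliate hσ.1
  rw [cohRelEntropy_eq_coherence hs, ← EReal.coe_mul, EReal.coe_le_coe_iff, Fin.sum_univ_succ]
  -- The completing outcome can only increase the sum.
  have h0 : 0 ≤ coherence (ampliate (Fin m) E (shiftMeasurement σ 0)) :=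
    coherence_nonneg (hE.completelyPositive m _ (hM.1.posSemidef 0))
  have hk (k : Fin m) : coherence (ampliate (Fin m) E (shiftMeasurement σ k.succ)) =
      coherence (ampliate (Fin m) E σ) :=
    coherence_submatrix hs.posSemidef.isHermitian (ancillaShift ι k)
  rw [Finset.sum_congr rfl fun k _ => hk k, Finset.sum_const, Finset.card_univ, Fintype.card_prod,
    Fintype.card_fin, nsmul_eq_mul]
  have hm' : (0 : ℝ) < m := by exact_mod_cast hm
  push_cast
  calc 1 / (Fintype.card ι : ℝ) * coherence (ampliate (Fin m) E σ)
      = 1 / (Fintype.card ι * m : ℝ) * (m * coherence (ampliate (Fin m) E σ)) := by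
        field_simp
    _ ≤ _ := by gcongr; exact le_add_of_nonneg_left h0

end Inequalities

end CoheringPower

end

theorem theorem7 (d : ℕ) (hd : 1 ≤ d)
    (E : Matrix (Fin d) (Fin d) ℂ →ₗ[ℂ] Matrix (Fin d) (Fin d) ℂ)
    (hE : CoheringPower.IsChannel E) (hunital : CoheringPower.IsUnital E) :
    ((1 / (d : ℝ) : ℝ) : EReal) * CoheringPower.stateCoheringPower E ≤
        CoheringPower.measCoheringPower (CoheringPower.adjointMap E) ∧
      CoheringPower.measCoheringPower (CoheringPower.adjointMap E) ≤
        CoheringPower.stateCoheringPower E ∧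
      (CoheringPower.stateCoheringPower E ≠ 0 ↔
        CoheringPower.measCoheringPower (CoheringPower.adjointMap E) ≠ 0) := by
  have : Nonempty (Fin d) := ⟨⟨0, hd⟩⟩
  have lower := CoheringPower.stateCoheringPower_le_measCoheringPower hE
  have upper := CoheringPower.measCoheringPower_adjointMap_le hE hunital
  rw [Fintype.card_fin] at lower
  refine ⟨lower, upper, not_congr ⟨fun h => ?_, fun h => ?_⟩⟩
  · rw [h, mul_zero] at lower
    rw [h] at upper
    exact le_antisymm upper lower
  · rw [h] at lower upper
    -- Since 1/d is positive, the lower bound forces C_g(E) ≤ 0, and the upper bound gives C_g(E) ≥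
    -- 0.
    have hpos : (0 : ℝ) < 1 / (d : ℝ) := by positivity
    rw [mul_comm, ← EReal.le_div_iff_mul_le (EReal.coe_pos.2 hpos) (EReal.coe_ne_top _),
      EReal.zero_div] at lower
    exact le_antisymm lower upper
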